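/- Let $V$ be a real vector space and $C\subseteq V$ a cone, i.e. $C$ is convex, $\lambda C\subseteq C$ for all $\lambda\ge 0$, and $C\cap(-C)=\{0\}$; write $x\le_C y$ if $y-x\in C$. Suppose that $(V,C,u)$ is an order unit space: $C$ is Archimedean (if $x\in V$, $y\in C$ and $nx\le_C y$ for all $n=1,2,\dots$, then $x\le_C 0$), and $u\in C$ is an order unit (for each $x\in V$ there is $\lambda\ge 0$ with $x\le_C\lambda u$). Equip $V$ with the order unit norm $\|x\|_u=\inf\{\lambda>0: -\lambda u\le_C x\le_C\lambda u\}$ and let $C^\circ$ and $\partial C$ be the interior and the boundary of $C$ for this norm. Suppose that $C$ is strictly convex: for all linearly independent $x,y\in\partial C$ and all $0<\lambda<1$, $(1-\lambda)x+\lambda y\in C^\circ$. Let $g\colon C^\circ\to C^\circ$ be a bijective antihomogeneous order-antimorphism, i.e. a bijection with $x\le_C y\iff g(y)\le_C g(x)$ and $g(\lambda x)=\lambda^{-1}g(x)$ for all $x,y\in C^\circ$ and $\lambda>0$. Then for each $x\in C^\circ$ the limit $$G_x(z):=-\lim_{t\to 0}\frac{g(x+tz)-g(x)}{t}$$ exists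 (in norm) for every $z\in V$. The map $G_x\colon V\to V$ is a linear bijection, bounded with bounded inverse, and $G_x(C)=C$. The map $S_x:=G_x^{-1}\circ g$ is a bijective antihomogeneous order-antimorphism of $C^\circ$, and 1. $S_x(x)=x$; 2. $S_x(S_x(y))=y$ for all $y\in C^\circ$. -/

import Mathlib

/-- The relation `x ≤_C y` induced by a cone `C`: `y - x ∈ C`. -/
def coneLE {V : Type*} [AddCommGroup V] [Module ℝ V] (C : PointedCone ℝ V) (x y : V) : Prop :=
  y - x ∈ C

/-- `(V, C, u)` is an order unit space: `C` is an Archimedean cone in the real vector space `V`,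
`u ∈ C` is an order unit, and `V` carries the order unit norm
`‖x‖ = inf {r > 0 : -r u ≤_C x ≤_C r u}` (so that topological notions in `V` refer to that norm).
A `PointedCone` is a set containing `0` and closed under addition and under multiplication by
nonnegative reals. -/
structure IsOrderUnitSpace {V : Type*} [NormedAddCommGroup V] [NormedSpace ℝ V]
    (C : PointedCone ℝ V) (u : V) : Prop where
  /-- `C ∩ -C = {0}` -/
  salient : ∀ x ∈ C, -x ∈ C → x = 0
  archimedean : ∀ x : V, ∀ y ∈ C, (∀ n : ℕ, 1 ≤ n → coneLE C ((n : ℝ) • x) y) → coneLE C x 0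
  unit_mem : u ∈ C
  order_unit : ∀ x : V, ∃ r : ℝ, 0 ≤ r ∧ coneLE C x (r • u)
  norm_eq : ∀ x : V, ‖x‖ = sInf {r : ℝ | 0 < r ∧ coneLE C (-(r • u)) x ∧ coneLE C x (r • u)}

/-- `C` is strictly convex: the open segment between two linearly independent boundary points
lies in the interior. -/
def IsStrictlyConvexCone {V : Type*} [NormedAddCommGroup V] [NormedSpace ℝ V]
    (C : PointedCone ℝ V) : Prop :=
  ∀ x ∈ frontier (C : Set V), ∀ y ∈ frontier (C : Set V), LinearIndependent ℝ ![x, y] →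
    ∀ r : ℝ, 0 < r → r < 1 → (1 - r) • x + r • y ∈ interior (C : Set V)

/-- `g` restricts to a bijective antihomogeneous order-antimorphism of the interior of `C`. (The
values of `g` outside the interior play no role.) -/
structure IsAntihomogeneousOrderAntimorphism {V : Type*} [NormedAddCommGroup V] [NormedSpace ℝ V]
    (C : PointedCone ℝ V) (g : V → V) : Prop where
  bijOn : Set.BijOn g (interior (C : Set V)) (interior (C : Set V))
  antitone_iff : ∀ x ∈ interior (C : Set V), ∀ y ∈ interior (C : Set V),
    (coneLE C x y ↔ coneLE C (g y) (g x))
  antihomogeneous : ∀ r : ℝ, 0 < r → ∀ x ∈ interior (C : Set V), g (r • x) = r⁻¹ • g x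

/-!
The proof reduces everything to planes. If `x ≤ y` and `y - x` is a nonzero boundary point of `C`,
then by strict convexity the order interval from `x` to `y` is a segment
(`IsOrderUnitSpace.exists_eq_smul_add`). The map `g` takes order intervals to order intervals and
boundary differences to boundary differences, so it takes lines in boundary directions to lines
(`exists_map_smul_add_eq`). Together with antihomogeneity this shows that in a plane spanned by two
boundary points `p`, `q` with `p + q` in the interior,
`g (α • p + β • q) = α⁻¹ • p' + β⁻¹ • q'` for suitable `p'`, `q'` (`exists_map_eq_inv`).

Every `z` lies in such a plane with `p + q = x` (`exists_boundary_decomposition`), or is a multiple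
of `x`. Hence the Gateaux derivative of `g` at `x` exists, and its negative `G` maps
`a • p + b • q` to `a • p' + b • q'`. The same formula for `g⁻¹` at `g x` gives the inverse of `G`.
The coordinates depend on the plane, so linearity of `G` is not yet visible; but `G` is an order
isomorphism, as a limit of difference quotients, and `G (z + s • x) = G z + s • g x`. It is
therefore an isometry between the order unit norms of `x` and of `g x`, and the Mazur-Ulam theorem
makes it linear (`isLinearMap_of_monotone`). Finally `G⁻¹ ∘ g` is the map
`α • p + β • q ↦ α⁻¹ • p + β⁻¹ • q` in each of the planes through `x`, which is an involution
fixing `x`.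
-/

open Filter Topology Set

/-! ### Isometries for seminorms -/

/-- A version of the Mazur-Ulam theorem for norms that are not instances. -/
theorem isLinearMap_of_seminorm_isometry {E F : Type*} [AddCommGroup E] [Module ℝ E]
    [AddCommGroup F] [Module ℝ F] (p : Seminorm ℝ E) (q : Seminorm ℝ F)
    (hp : ∀ x, p x = 0 → x = 0) (hq : ∀ x, q x = 0 → x = 0)
    (f : E ≃ F) (h0 : f 0 = 0) (hf : ∀ x y, q (f x - f y) = p (x - y)) : IsLinearMap ℝ f := by
  let : NormedAddCommGroup E := AddGroupNorm.toNormedAddCommGroup ⟨p.toAddGroupSeminorm, hp⟩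
  let : NormedAddCommGroup F := AddGroupNorm.toNormedAddCommGroup ⟨q.toAddGroupSeminorm, hq⟩
  let : NormedSpace ℝ E := { norm_smul_le := fun a x => (map_smul_eq_mul p a x).le }
  let : NormedSpace ℝ F := { norm_smul_le := fun a x => (map_smul_eq_mul q a x).le }
  have hi : Isometry f := Isometry.of_dist_eq fun x y => by
    rw [dist_eq_norm, dist_eq_norm]
    exact hf x y
  let e := IsometryEquiv.toRealLinearIsometryEquivOfMapZero ⟨f, hi⟩ h0
  exact ⟨fun x y => e.map_add x y, fun c x => e.map_smul c x⟩

/-! ### The cone of an order unit space -/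

namespace IsOrderUnitSpace

variable {V : Type*} [NormedAddCommGroup V] [NormedSpace ℝ V] {C : PointedCone ℝ V} {u : V}

theorem norm_le (hV : IsOrderUnitSpace C u) {z : V} {r : ℝ} (hr : 0 < r)
    (h₁ : r • u - z ∈ C) (h₂ : r • u + z ∈ C) : ‖z‖ ≤ r := by
  rw [hV.norm_eq]
  refine csInf_le ⟨0, fun s hs => hs.1.le⟩ ⟨hr, ?_, h₁⟩
  simpa [coneLE, add_comm] using h₂

theorem mem_of_norm_lt (hV : IsOrderUnitSpace C u) {z : V} {r : ℝ} (h : ‖z‖ < r) :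
    r • u - z ∈ C ∧ r • u + z ∈ C := by
  rw [hV.norm_eq] at h
  obtain ⟨s, ⟨hs, h₁, h₂⟩, hsr⟩ := exists_lt_of_csInf_lt (by
    obtain ⟨a, ha, ha'⟩ := hV.order_unit z
    obtain ⟨b, hb, hb'⟩ := hV.order_unit (-z)
    refine ⟨a + b + 1, by positivity, ?_, ?_⟩
    · have := C.add_mem hb' (PointedCone.smul_mem C (by positivity : 0 ≤ a + 1) hV.unit_mem)
      simp only [coneLE]
      convert this using 1
      module
    · have := C.add_mem ha' (PointedCone.smul_mem C (by positivity : 0 ≤ b + 1) hV.unit_mem)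
      simp only [coneLE]
      convert this using 1
      module) h
  have hu := PointedCone.smul_mem C (sub_nonneg.2 hsr.le) hV.unit_mem
  simp only [coneLE] at h₁ h₂
  constructor
  · convert C.add_mem hu h₂ using 1
    module
  · convert C.add_mem hu h₁ using 1
    module

/-- If `x` is a limit of points of `C`, then `-x ≤ n⁻¹ • u` for all `n`, and `C` is Archimedean. -/
theorem isClosed (hV : IsOrderUnitSpace C u) : IsClosed (C : Set V) := by
  rw [← isSeqClosed_iff_isClosed]
  intro y x hy hyx
  have key : coneLE C (-x) 0 := by
    refine hV.archimedean (-x) u hV.unit_mem fun n hn => ?_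
    have hn : (0 : ℝ) < n := by exact_mod_cast hn
    obtain ⟨k, hk⟩ := (((tendsto_iff_norm_sub_tendsto_zero.1 hyx).eventually
      (gt_mem_nhds (show 0 < (n : ℝ)⁻¹ by positivity)))).exists
    have h := PointedCone.smul_mem C hn.le (C.add_mem (hV.mem_of_norm_lt hk).1 (hy k))
    simp only [coneLE]
    convert h using 1
    have : (n : ℝ) * (n : ℝ)⁻¹ = 1 := by field_simp
    linear_combination (norm := module) (-this) • u
  simpa [coneLE] using key

theorem mem_interior_iff (hV : IsOrderUnitSpace C u) {x : V} :
    x ∈ interior (C : Set V) ↔ ∃ ε : ℝ, 0 < ε ∧ x - ε • u ∈ C := by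
  constructor
  · intro hx
    have hc : Tendsto (fun t : ℝ => x - t • u) (𝓝[>] 0) (𝓝 x) := by
      refine tendsto_nhdsWithin_of_tendsto_nhds ?_
      have : Continuous fun t : ℝ => x - t • u := by fun_prop
      simpa using this.tendsto 0
    obtain ⟨t, ht, ht0⟩ := ((hc.eventually (mem_interior_iff_mem_nhds.1 hx)).and
      self_mem_nhdsWithin).exists
    exact ⟨t, ht0, ht⟩
  · rintro ⟨ε, hε, h⟩
    rw [mem_interior_iff_mem_nhds]
    refine Filter.mem_of_superset (Metric.ball_mem_nhds x hε) fun y hy => ?_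
    rw [mem_ball_iff_norm] at hy
    have := C.add_mem h (hV.mem_of_norm_lt hy).2
    rwa [show x - ε • u + (ε • u + (y - x)) = y by abel] at this

theorem add_mem_interior (hV : IsOrderUnitSpace C u) {x y : V} (hx : x ∈ interior (C : Set V))
    (hy : y ∈ C) : x + y ∈ interior (C : Set V) := by
  obtain ⟨ε, hε, h⟩ := hV.mem_interior_iff.1 hx
  refine hV.mem_interior_iff.2 ⟨ε, hε, ?_⟩
  convert C.add_mem h hy using 1
  module

theorem smul_mem_interior (hV : IsOrderUnitSpace C u) {x : V} (hx : x ∈ interior (C : Set V))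
    {r : ℝ} (hr : 0 < r) : r • x ∈ interior (C : Set V) := by
  obtain ⟨ε, hε, h⟩ := hV.mem_interior_iff.1 hx
  refine hV.mem_interior_iff.2 ⟨r * ε, by positivity, ?_⟩
  convert PointedCone.smul_mem C hr.le h using 1
  module

theorem smul_add_smul_mem_interior (hV : IsOrderUnitSpace C u) {p q : V} (hp : p ∈ C) (hq : q ∈ C)
    (hpq : p + q ∈ interior (C : Set V)) {α β : ℝ} (hα : 0 < α) (hβ : 0 < β) :
    α • p + β • q ∈ interior (C : Set V) := by
  convert hV.add_mem_interior (hV.add_mem_interior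
    (hV.smul_mem_interior hpq (lt_min hα hβ))
    (PointedCone.smul_mem C (sub_nonneg.2 (min_le_left α β)) hp))
    (PointedCone.smul_mem C (sub_nonneg.2 (min_le_right α β)) hq) using 1
  module

theorem exists_sub_smul_mem_interior {x : V}
    (hx : x ∈ interior (C : Set V)) (z : V) :
    ∃ ε : ℝ, 0 < ε ∧ ε < 1 ∧ x - ε • z ∈ interior (C : Set V) := by
  have hc : Tendsto (fun t : ℝ => x - t • z) (𝓝[>] 0) (𝓝 x) := by
    refine tendsto_nhdsWithin_of_tendsto_nhds ?_
    have : Continuous fun t : ℝ => x - t • z := by fun_prop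
    simpa using this.tendsto 0
  obtain ⟨t, ⟨ht, ht0⟩, ht1⟩ := (((hc.eventually (isOpen_interior.mem_nhds hx)).and
    self_mem_nhdsWithin).and (nhdsWithin_le_nhds (gt_mem_nhds zero_lt_one))).exists
  exact ⟨t, ht0, ht1, ht⟩

/-- If `0` is interior, then `v` and `-v` belong to `C` for every `v`, so that `V` is zero. -/
theorem zero_notMem_interior [Nontrivial V] (hV : IsOrderUnitSpace C u) :
    (0 : V) ∉ interior (C : Set V) := by
  intro h0
  obtain ⟨v, hv⟩ := exists_ne (0 : V)
  obtain ⟨ε, hε, -, h⟩ := exists_sub_smul_mem_interior h0 v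
  obtain ⟨δ, hδ, -, h'⟩ := exists_sub_smul_mem_interior h0 (-v)
  have h₁ := PointedCone.smul_mem C (inv_pos.2 hε).le (interior_subset h)
  have h₂ := PointedCone.smul_mem C (inv_pos.2 hδ).le (interior_subset h')
  simp only [zero_sub, smul_neg, neg_neg, inv_smul_smul₀ hε.ne', inv_smul_smul₀ hδ.ne'] at h₁ h₂
  exact hv (hV.salient v h₂ h₁)

theorem pos_of_smul_mem_interior [Nontrivial V] (hV : IsOrderUnitSpace C u) {p : V} (hp : p ∈ C)
    {b : ℝ} (h : b • p ∈ interior (C : Set V)) : 0 < b := by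
  by_contra! hb
  have := hV.add_mem_interior h (PointedCone.smul_mem C (neg_nonneg.2 hb) hp)
  refine hV.zero_notMem_interior ?_
  simpa using this

theorem smul_notMem_interior [Nontrivial V] (hV : IsOrderUnitSpace C u) {p : V} (hp : p ∈ C)
    (hp' : p ∉ interior (C : Set V)) (b : ℝ) : b • p ∉ interior (C : Set V) := by
  intro h
  have hb := hV.pos_of_smul_mem_interior hp h
  refine hp' ?_
  have := hV.smul_mem_interior h (inv_pos.2 hb)
  rwa [inv_smul_smul₀ hb.ne'] at this

/-- The line through `z` in the direction `x` leaves the cone at the boundary point `z - a • x`,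
where `a` is the largest real with `a • x ≤ z`. -/
theorem exists_sub_smul_mem_boundary [Nontrivial V] (hV : IsOrderUnitSpace C u) {x : V}
    (hx : x ∈ interior (C : Set V)) (z : V) :
    ∃ a : ℝ, z - a • x ∈ C ∧ z - a • x ∉ interior (C : Set V) := by
  set T : Set ℝ := {t | z - t • x ∈ C} with hT
  have hne : T.Nonempty := by
    obtain ⟨ε, hε, -, h⟩ := exists_sub_smul_mem_interior hx (-z)
    refine ⟨-ε⁻¹, ?_⟩
    have := PointedCone.smul_mem C (inv_pos.2 hε).le (interior_subset h)
    rw [hT, mem_ofPred_eq]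
    convert this using 1
    rw [smul_sub, smul_smul, inv_mul_cancel₀ hε.ne']
    module
  have hbdd : BddAbove T := by
    obtain ⟨ε, hε, -, h⟩ := exists_sub_smul_mem_interior hx z
    refine ⟨ε⁻¹, fun t ht => ?_⟩
    have h₁ := hV.add_mem_interior (hV.smul_mem_interior h (inv_pos.2 hε)) ht
    have h₂ : ε⁻¹ • (x - ε • z) + (z - t • x) = (ε⁻¹ - t) • x := by
      rw [smul_sub, smul_smul, inv_mul_cancel₀ hε.ne']
      module
    rw [h₂] at h₁
    linarith [hV.pos_of_smul_mem_interior (interior_subset hx) h₁]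
  have hcl : IsClosed T := hV.isClosed.preimage (f := fun t : ℝ => z - t • x) (by fun_prop)
  refine ⟨sSup T, hcl.csSup_mem hne hbdd, fun hi => ?_⟩
  obtain ⟨ε, hε, -, h⟩ := exists_sub_smul_mem_interior hi x
  have : sSup T + ε ∈ T := by
    rw [hT, mem_ofPred_eq]
    rw [add_smul, ← sub_sub]
    exact interior_subset h
  linarith [le_csSup hbdd this]

/-- The plane spanned by `x` and `z` meets the boundary of `C` in the rays of `z - a • x` and
`b • x - z`, with `a` maximal and `b` minimal; suitable multiples of these two points add up to
`x`. -/
theorem exists_boundary_decomposition [Nontrivial V] (hV : IsOrderUnitSpace C u) {x : V}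
    (hx : x ∈ interior (C : Set V)) (z : V) :
    (∃ c : ℝ, z = c • x) ∨ ∃ p q : V, ∃ a b : ℝ, p ∈ C ∧ p ∉ interior (C : Set V) ∧
      q ∈ C ∧ q ∉ interior (C : Set V) ∧ p + q = x ∧ z = a • p + b • q := by
  obtain ⟨a, ha, ha'⟩ := hV.exists_sub_smul_mem_boundary hx z
  obtain ⟨b', hb, hb'⟩ := hV.exists_sub_smul_mem_boundary hx (-z)
  obtain ⟨b, rfl⟩ : ∃ b, b' = -b := ⟨-b', by simp⟩
  rcases lt_trichotomy a b with h | h | h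
  · right
    have hab : 0 < b - a := sub_pos.2 h
    refine ⟨(b - a)⁻¹ • (z - a • x), (b - a)⁻¹ • (-z - (-b) • x), b, a,
      PointedCone.smul_mem C (inv_pos.2 hab).le ha, hV.smul_notMem_interior ha ha' _,
      PointedCone.smul_mem C (inv_pos.2 hab).le hb, hV.smul_notMem_interior hb hb' _, ?_, ?_⟩
    · rw [← smul_add]
      refine (inv_smul_eq_iff₀ hab.ne').2 ?_
      module
    · have : (b - a) * (b - a)⁻¹ = 1 := mul_inv_cancel₀ hab.ne'
      linear_combination (norm := module) (-this) • z
  · left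
    refine ⟨a, sub_eq_zero.1 (hV.salient _ ha ?_)⟩
    convert hb using 1
    rw [h]
    module
  · exfalso
    have h₁ := C.add_mem ha hb
    have h₂ : z - a • x + (-z - (-b) • x) = (b - a) • x := by module
    rw [h₂] at h₁
    have h₃ := hV.add_mem_interior (hV.smul_mem_interior hx (sub_pos.2 h)) h₁
    refine hV.zero_notMem_interior ?_
    convert h₃ using 1
    module

/-- If `a, b ∈ C` and `a + b` is a boundary point, then strict convexity forces `a` and `b` onto
the ray of `a + b`: every ray in the boundary is a face. -/
theorem exists_eq_smul_add (hV : IsOrderUnitSpace C u) (hC : IsStrictlyConvexCone C) {a b : V}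
    (ha : a ∈ C) (hb : b ∈ C) (hab : a + b ∉ interior (C : Set V)) : ∃ c : ℝ, a = c • (a + b) := by
  have hfr : ∀ v ∈ C, v ∉ interior (C : Set V) → v ∈ frontier (C : Set V) := fun v hv hv' => by
    rw [hV.isClosed.frontier_eq]
    exact ⟨hv, hv'⟩
  have ha' : a ∉ interior (C : Set V) := fun h => hab (hV.add_mem_interior h hb)
  have hb' : b ∉ interior (C : Set V) := fun h => hab (add_comm b a ▸ hV.add_mem_interior h ha)
  have hdep : ¬ LinearIndependent ℝ ![a, b] := fun h => by
    have := hC a (hfr a ha ha') b (hfr b hb hb') h (1 / 2) (by norm_num) (by norm_num)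
    refine hab ?_
    convert hV.smul_mem_interior this (zero_lt_two' ℝ) using 1
    module
  rw [LinearIndependent.pair_iff] at hdep
  push Not at hdep
  obtain ⟨s, t, hst, hne⟩ := hdep
  by_cases h : s = t
  · subst h
    have hs : s ≠ 0 := fun h => hne h h
    rw [← smul_add, smul_eq_zero, or_iff_right hs] at hst
    refine ⟨0, ?_⟩
    rw [zero_smul]
    exact hV.salient a ha (by rwa [neg_eq_of_add_eq_zero_right hst])
  · have hs : s - t ≠ 0 := sub_ne_zero.2 h
    refine ⟨-t / (s - t), ?_⟩
    have : (s - t) • a = (s - t) • ((-t / (s - t)) • (a + b)) := by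
      rw [smul_smul, mul_div_cancel₀ _ hs]
      linear_combination (norm := module) hst
    exact smul_right_injective V hs this

/-! ### Linearity of order isomorphisms that respect translations along an interior point -/

/-- The order interval `[-x, x]`. Its gauge is the order unit norm with respect to `x`. -/
def interval (C : PointedCone ℝ V) (x : V) : Set V := {z | x - z ∈ C ∧ x + z ∈ C}

theorem balanced_interval (x : V) : Balanced ℝ (interval C x) := by
  rintro a ha _ ⟨z, ⟨h₁, h₂⟩, rfl⟩
  rw [Real.norm_eq_abs, abs_le] at ha
  have h : ∀ {s t : ℝ}, 0 ≤ s → 0 ≤ t → s • (x - z) + t • (x + z) ∈ C := fun hs ht =>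
    C.add_mem (PointedCone.smul_mem C hs h₁) (PointedCone.smul_mem C ht h₂)
  constructor
  · convert h (s := (1 + a) / 2) (t := (1 - a) / 2) (by linarith) (by linarith) using 1
    module
  · convert h (s := (1 - a) / 2) (t := (1 + a) / 2) (by linarith) (by linarith) using 1
    module

theorem convex_interval (x : V) : Convex ℝ (interval C x) := by
  rintro y ⟨h₁, h₂⟩ z ⟨h₃, h₄⟩ a b ha hb hab
  obtain rfl : b = 1 - a := by linarith
  constructor
  · convert C.add_mem (PointedCone.smul_mem C ha h₁) (PointedCone.smul_mem C hb h₃) using 1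
    module
  · convert C.add_mem (PointedCone.smul_mem C ha h₂) (PointedCone.smul_mem C hb h₄) using 1
    module

theorem interval_mem_nhds {x : V} (hx : x ∈ interior (C : Set V)) : interval C x ∈ 𝓝 (0 : V) := by
  have h₁ : ∀ᶠ z in 𝓝 (0 : V), x - z ∈ C :=
    (show Continuous fun z : V => x - z by fun_prop).tendsto' 0 x (by simp)
      |>.eventually (mem_interior_iff_mem_nhds.1 hx)
  have h₂ : ∀ᶠ z in 𝓝 (0 : V), x + z ∈ C :=
    (show Continuous fun z : V => x + z by fun_prop).tendsto' 0 x (by simp)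
      |>.eventually (mem_interior_iff_mem_nhds.1 hx)
  exact h₁.and h₂

theorem isVonNBounded_interval (hV : IsOrderUnitSpace C u) (x : V) :
    Bornology.IsVonNBounded ℝ (interval C x) := by
  obtain ⟨r, hr, h⟩ := hV.order_unit x
  refine NormedSpace.isVonNBounded_of_isBounded ℝ
    (isBounded_iff_forall_norm_le.2 ⟨r + 1, fun z hz => hV.norm_le (by positivity) ?_ ?_⟩)
  · convert C.add_mem (C.add_mem h hz.1) hV.unit_mem using 1
    module
  · convert C.add_mem (C.add_mem h hz.2) hV.unit_mem using 1
    module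

/-- A bijection that is isotone in both directions, fixes `0` and turns translation along `x` into
translation along `y` is an isometry between the order unit norms of `x` and `y`; hence it is
linear by the Mazur-Ulam theorem. -/
theorem isLinearMap_of_monotone (hV : IsOrderUnitSpace C u) {x y : V}
    (hx : x ∈ interior (C : Set V)) (hy : y ∈ interior (C : Set V)) (G : V ≃ V) (h0 : G 0 = 0)
    (hle : ∀ z w, w - z ∈ C ↔ G w - G z ∈ C) (hadd : ∀ (s : ℝ) z, G (z + s • x) = G z + s • y) :
    IsLinearMap ℝ G := by
  have key : ∀ z w, ∀ r : ℝ, 0 < r →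
      (r⁻¹ • (z - w) ∈ interval C x ↔ r⁻¹ • (G z - G w) ∈ interval C y) := by
    intro z w r hr
    have hmul : ∀ v : V, v ∈ C ↔ r • v ∈ C := fun v =>
      ⟨fun h => PointedCone.smul_mem C hr.le h, fun h => by
        simpa [inv_smul_smul₀ hr.ne'] using PointedCone.smul_mem C (inv_pos.2 hr).le h⟩
    simp only [interval, mem_ofPred_eq]
    rw [hmul, hmul (x + _), hmul (y - _), hmul (y + _)]
    simp only [smul_add, smul_sub, smul_inv_smul₀ hr.ne']
    have e₁ : r • x - (z - w) = (w + r • x) - z := by abel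
    have e₂ : r • x + (z - w) = (z + r • x) - w := by abel
    have e₃ : r • y - (G z - G w) = (G w + r • y) - G z := by abel
    have e₄ : r • y + (G z - G w) = (G z + r • y) - G w := by abel
    rw [e₁, e₂, e₃, e₄, hle, hle w, hadd, hadd]
  have hdef : ∀ {v : V}, v ∈ interior (C : Set V) → ∀ z, gauge (interval C v) z = 0 → z = 0 :=
    fun hv z hz => (gauge_eq_zero (absorbent_nhds_zero (interval_mem_nhds hv))
      (hV.isVonNBounded_interval _)).1 hz
  refine isLinearMap_of_seminorm_isometry
    (gaugeSeminorm (balanced_interval x) (convex_interval x)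
      (absorbent_nhds_zero (interval_mem_nhds hx)))
    (gaugeSeminorm (balanced_interval y) (convex_interval y)
      (absorbent_nhds_zero (interval_mem_nhds hy))) (hdef hx) (hdef hy) G h0 fun z w => ?_
  change gauge _ _ = gauge _ _
  rw [gauge_def', gauge_def']
  congr 1
  ext r
  exact and_congr_right fun hr => (key z w r hr).symm

theorem exists_norm_le_mul (hV : IsOrderUnitSpace C u) {G : V → V} (hG : IsLinearMap ℝ G)
    (hC : ∀ z ∈ C, G z ∈ C) : ∃ K : ℝ, ∀ z, ‖G z‖ ≤ K * ‖z‖ := by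
  obtain ⟨K, hK, h⟩ := hV.order_unit (G u)
  -- `K + 1` rather than `K`, to have a positive bound even if `K = 0`.
  refine ⟨K + 1, fun z => ?_⟩
  refine le_of_forall_pos_le_add fun ε hε => ?_
  set r := ‖z‖ + ε / (K + 1) with hr
  have hzr : ‖z‖ < r := by rw [hr]; linarith [show 0 < ε / (K + 1) by positivity]
  have hr0 : 0 < r := (norm_nonneg z).trans_lt hzr
  obtain ⟨h₁, h₂⟩ := hV.mem_of_norm_lt hzr
  have e : (K + 1) * ‖z‖ + ε = (K + 1) * r := by rw [hr]; field_simp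
  rw [e]
  have h₁ := hC _ h₁
  have h₂ := hC _ h₂
  rw [hG.map_sub, hG.map_smul] at h₁
  rw [hG.map_add, hG.map_smul] at h₂
  have h₃ : (K + 1) • u - G u ∈ C := by
    convert C.add_mem h hV.unit_mem using 1
    module
  have h₄ := PointedCone.smul_mem C hr0.le h₃
  refine hV.norm_le (by positivity) ?_ ?_
  · convert C.add_mem h₁ h₄ using 1
    module
  · convert C.add_mem h₂ h₄ using 1
    module

end IsOrderUnitSpace

/-! ### Antimorphisms in planes -/

namespace IsAntihomogeneousOrderAntimorphism

variable {V : Type*} [NormedAddCommGroup V] [NormedSpace ℝ V] {C : PointedCone ℝ V} {u : V}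
  {g h : V → V}

theorem sub_mem_iff (hg : IsAntihomogeneousOrderAntimorphism C g) {x y : V}
    (hx : x ∈ interior (C : Set V)) (hy : y ∈ interior (C : Set V)) :
    y - x ∈ C ↔ g x - g y ∈ C :=
  hg.antitone_iff x hx y hy

theorem of_invOn (hg : IsAntihomogeneousOrderAntimorphism C g) (hV : IsOrderUnitSpace C u)
    (hl : LeftInvOn h g (interior C)) (hr : RightInvOn h g (interior C))
    (hh : MapsTo h (interior C) (interior C)) : IsAntihomogeneousOrderAntimorphism C h where
  bijOn := hg.bijOn.symm ⟨hr, hl⟩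
  antitone_iff x hx y hy := by
    have := hg.antitone_iff (h y) (hh hy) (h x) (hh hx)
    rw [hr hx, hr hy] at this
    exact this.symm
  antihomogeneous r hr0 x hx := by
    have := hg.antihomogeneous r⁻¹ (inv_pos.2 hr0) (h x) (hh hx)
    rw [hr hx, inv_inv] at this
    rw [← this, hl (hV.smul_mem_interior (hh hx) (inv_pos.2 hr0))]

/-- Boundary differences are mapped to boundary differences, since `y - x ∈ interior C` means that
`x ≤ r • y` for some `r < 1`. -/
theorem sub_notMem_interior (hg : IsAntihomogeneousOrderAntimorphism C g)
    (hV : IsOrderUnitSpace C u) {x y : V} (hx : x ∈ interior (C : Set V))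
    (hy : y ∈ interior (C : Set V)) (hxy : y - x ∉ interior (C : Set V)) :
    g x - g y ∉ interior (C : Set V) := by
  intro hi
  obtain ⟨ε, hε, hε1, h⟩ := IsOrderUnitSpace.exists_sub_smul_mem_interior hi (g x)
  have hr : 0 < 1 - ε := by linarith
  have hx' := hV.smul_mem_interior hx (inv_pos.2 hr)
  have h₁ : y - (1 - ε)⁻¹ • x ∈ C := by
    rw [hg.sub_mem_iff hx' hy, hg.antihomogeneous _ (inv_pos.2 hr) x hx, inv_inv]
    have := interior_subset h
    rwa [show g x - g y - ε • g x = (1 - ε) • g x - g y by module] at this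
  have h₂ := hV.add_mem_interior (hV.smul_mem_interior hx' hε) h₁
  refine hxy ?_
  convert h₂ using 1
  have : (1 - ε) * (1 - ε)⁻¹ = 1 := mul_inv_cancel₀ hr.ne'
  linear_combination (norm := module) this • x

/-- On an interval `[x, x + t • p]` in a boundary direction `p`, the images of three points are
collinear: the image lies in the order interval from `g (x + t • p)` to `g x`, which is a segment
by strict convexity. -/
theorem exists_sub_eq_smul_sub (hg : IsAntihomogeneousOrderAntimorphism C g)
    (hV : IsOrderUnitSpace C u) (hC : IsStrictlyConvexCone C) [Nontrivial V] {x p : V}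
    (hx : x ∈ interior (C : Set V)) (hp : p ∈ C) (hp' : p ∉ interior (C : Set V)) {s t : ℝ}
    (hs : 0 ≤ s) (hst : s ≤ t) :
    ∃ c : ℝ, g x - g (x + s • p) = c • (g x - g (x + t • p)) := by
  have hxs := hV.add_mem_interior hx (PointedCone.smul_mem C hs hp)
  have hxt := hV.add_mem_interior hx (PointedCone.smul_mem C (hs.trans hst) hp)
  have e : (g x - g (x + s • p)) + (g (x + s • p) - g (x + t • p)) = g x - g (x + t • p) := by abel
  rw [← e]
  refine hV.exists_eq_smul_add hC ((hg.sub_mem_iff hx hxs).1 ?_) ((hg.sub_mem_iff hxs hxt).1 ?_) ?_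
  · simpa using PointedCone.smul_mem C hs hp
  · convert PointedCone.smul_mem C (sub_nonneg.2 hst) hp using 1
    module
  · rw [e]
    refine hg.sub_notMem_interior hV hx hxt ?_
    simpa using hV.smul_notMem_interior hp hp' t

/-- `g` maps the half-line of all `α • p + q` with `α > 0` into the line through the images of
`p + q` and `2 • p + q`. -/
theorem exists_map_smul_add_eq (hg : IsAntihomogeneousOrderAntimorphism C g)
    (hV : IsOrderUnitSpace C u) (hC : IsStrictlyConvexCone C) [Nontrivial V] {p q : V}
    (hp : p ∈ C) (hp' : p ∉ interior (C : Set V)) (hq : q ∈ C) (hq' : q ∉ interior (C : Set V))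
    (hpq : p + q ∈ interior (C : Set V)) {α : ℝ} (hα : 0 < α) :
    ∃ c : ℝ, g (α • p + q) = g (p + q) - c • (g (p + q) - g ((2 : ℝ) • p + q)) := by
  have hmem : ∀ {β : ℝ}, 0 < β → β • p + q ∈ interior (C : Set V) := fun hβ => by
    simpa using hV.smul_add_smul_mem_interior hp hq hpq hβ one_pos
  have hline : ∀ {a b c : ℝ}, 0 < a → a ≤ b → b ≤ c →
      ∃ k : ℝ, g (a • p + q) - g (b • p + q) = k • (g (a • p + q) - g (c • p + q)) := by
    intro a b c ha hab hbc
    have := hg.exists_sub_eq_smul_sub hV hC (hmem ha) hp hp' (sub_nonneg.2 hab)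
      (sub_le_sub_right hbc a)
    rwa [show a • p + q + (b - a) • p = b • p + q by module,
      show a • p + q + (c - a) • p = c • p + q by module] at this
  have hne : g (p + q) - g ((2 : ℝ) • p + q) ≠ 0 := by
    intro h0
    have := hg.bijOn.injOn hpq (hmem two_pos) (sub_eq_zero.1 h0)
    have hp0 : p = 0 := by
      linear_combination (norm := module) -this
    rw [hp0, zero_add] at hpq
    exact hq' hpq
  rcases le_total α 1 with h1 | h1
  · obtain ⟨k, hk⟩ := hline hα h1 one_le_two
    rw [one_smul] at hk
    have hk1 : 1 - k ≠ 0 := by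
      intro h
      obtain rfl : k = 1 := by linarith
      refine hne ?_
      linear_combination (norm := module) -hk
    refine ⟨-(k / (1 - k)), smul_right_injective V hk1 ?_⟩
    have : (1 - k) * (k / (1 - k)) = k := mul_div_cancel₀ _ hk1
    simp only
    linear_combination (norm := module) hk - this • (g (p + q) - g ((2 : ℝ) • p + q))
  rcases le_total α 2 with h2 | h2
  · obtain ⟨k, hk⟩ := hline one_pos h1 h2
    rw [one_smul] at hk
    exact ⟨k, by linear_combination (norm := module) -hk⟩
  · obtain ⟨k, hk⟩ := hline one_pos one_le_two h2
    rw [one_smul] at hk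
    have hk0 : k ≠ 0 := by
      rintro rfl
      exact hne (by rw [hk, zero_smul])
    refine ⟨k⁻¹, ?_⟩
    rw [hk, inv_smul_smul₀ hk0]
    abel

/-- In the plane spanned by two boundary rays, `g` is coordinatewise inversion. The half-lines in
the directions `p` and `q` go to half-lines in directions `p₁` and `q₁`; comparing the two
descriptions of `g (α • p + β • q)` that antihomogeneity gives determines both coefficients. -/
theorem exists_map_eq_inv (hg : IsAntihomogeneousOrderAntimorphism C g)
    (hV : IsOrderUnitSpace C u) (hC : IsStrictlyConvexCone C) [Nontrivial V] {p q : V}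
    (hp : p ∈ C) (hp' : p ∉ interior (C : Set V)) (hq : q ∈ C) (hq' : q ∉ interior (C : Set V))
    (hpq : p + q ∈ interior (C : Set V)) :
    ∃ p' q' : V, ∀ α β : ℝ, 0 < α → 0 < β → g (α • p + β • q) = α⁻¹ • p' + β⁻¹ • q' := by
  have hmem : ∀ {β : ℝ}, 0 < β → β • p + q ∈ interior (C : Set V) := fun hβ => by
    simpa using hV.smul_add_smul_mem_interior hp hq hpq hβ one_pos
  have hqp : q + p ∈ interior (C : Set V) := add_comm p q ▸ hpq
  have hqmem : ∀ {β : ℝ}, 0 < β → β • q + p ∈ interior (C : Set V) := fun hβ => by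
    simpa using hV.smul_add_smul_mem_interior hq hp hqp hβ one_pos
  set y := g (p + q) with hy
  have hyC : y ∈ interior (C : Set V) := hg.bijOn.mapsTo hpq
  set p₁ := y - g ((2 : ℝ) • p + q) with hp₁
  set q₁ := y - g ((2 : ℝ) • q + p) with hq₁
  have hp₁C : p₁ ∈ C := (hg.sub_mem_iff hpq (hmem two_pos)).1 (by
    convert hp using 1
    module)
  have hp₁' : p₁ ∉ interior (C : Set V) := hg.sub_notMem_interior hV hpq (hmem two_pos) (by
    convert hp' using 2
    module)
  have hφ : ∀ α : ℝ, 0 < α → ∃ c : ℝ, g (α • p + q) = y - c • p₁ := fun α hα =>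
    hg.exists_map_smul_add_eq hV hC hp hp' hq hq' hpq hα
  have hψ : ∀ α : ℝ, 0 < α → ∃ c : ℝ, g (α • q + p) = y - c • q₁ := fun α hα => by
    have := hg.exists_map_smul_add_eq hV hC hq hq' hp hp' hqp hα
    rwa [add_comm q p] at this
  -- The two families of lines are related by antihomogeneity.
  have hswap : ∀ t : ℝ, 0 < t → g (t • q + p) = t⁻¹ • g (t⁻¹ • p + q) := fun t ht => by
    rw [← hg.antihomogeneous t ht _ (hmem (inv_pos.2 ht)), smul_add, smul_inv_smul₀ ht.ne',
      add_comm]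
  have hq₁C : q₁ ∈ C := by
    have := (hg.sub_mem_iff hqp (hqmem two_pos)).1 (by
      convert hq using 1
      module)
    rwa [add_comm q p] at this
  have hq₁' : q₁ ∉ interior (C : Set V) := by
    have := hg.sub_notMem_interior hV hqp (hqmem two_pos) (by
      convert hq' using 2
      module)
    rwa [add_comm q p] at this
  obtain ⟨c, hc⟩ := hφ 2⁻¹ (by norm_num)
  obtain ⟨d, hd⟩ := hψ 2⁻¹ (by norm_num)
  have h₁ : y = (2 : ℝ) • q₁ - c • p₁ := by
    have := hswap 2 two_pos
    rw [hc] at this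
    linear_combination (norm := module) (2 : ℝ) • this + (2 : ℝ) • hq₁
  have h₂ : y = (2 : ℝ) • p₁ - d • q₁ := by
    have := hswap 2⁻¹ (by norm_num)
    rw [hd, inv_inv] at this
    linear_combination (norm := module) -this - (2 : ℝ) • hp₁
  -- `p₁` and `q₁` are independent because `y` lies in their span but on no boundary ray.
  have hind : ∀ a b : ℝ, a • p₁ + b • q₁ = 0 → a = 0 ∧ b = 0 := by
    intro a b hab
    constructor
    · by_contra ha
      have e : p₁ = (-(b / a)) • q₁ := by
        refine smul_right_injective V ha ?_
        have : a * (b / a) = b := mul_div_cancel₀ _ ha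
        simp only
        linear_combination (norm := module) hab + this • q₁
      refine hV.smul_notMem_interior hq₁C hq₁' (2 - c * (-(b / a))) ?_
      convert hyC using 1
      rw [h₁, e]
      module
    · by_contra hb
      have e : q₁ = (-(a / b)) • p₁ := by
        refine smul_right_injective V hb ?_
        have : b * (a / b) = a := mul_div_cancel₀ _ hb
        simp only
        linear_combination (norm := module) hab + this • p₁
      refine hV.smul_notMem_interior hp₁C hp₁' (2 - d * (-(a / b))) ?_
      convert hyC using 1
      rw [h₂, e]
      module
  have hsum : y = (2 : ℝ) • p₁ + (2 : ℝ) • q₁ := by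
    have := (hind (-c - 2) (2 + d) (by linear_combination (norm := module) h₂ - h₁)).1
    obtain rfl : c = -2 := by linarith
    rw [h₁]
    module
  refine ⟨(2 : ℝ) • p₁, (2 : ℝ) • q₁, fun α β hα hβ => ?_⟩
  have hαβ : 0 < α / β := div_pos hα hβ
  obtain ⟨a, ha⟩ := hφ (α / β) hαβ
  obtain ⟨b, hb⟩ := hψ (β / α) (div_pos hβ hα)
  have hs := hswap (β / α) (div_pos hβ hα)
  rw [inv_div, ha, hb] at hs
  have hcoef := (hind (2 - α / β * (2 - a)) (2 - b - α / β * 2) (by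
    linear_combination (norm := module) hs + (α / β - 1) • hsum)).1
  have hcoef' : β⁻¹ * (2 - a) = α⁻¹ * 2 := by
    field_simp at hcoef ⊢
    linarith
  have hβα : β * (α / β) = α := mul_div_cancel₀ _ hβ.ne'
  have e : α • p + β • q = β • ((α / β) • p + q) := by
    rw [smul_add, smul_smul, hβα]
  rw [e, hg.antihomogeneous β hβ _ (hmem hαβ), ha]
  linear_combination (norm := module) β⁻¹ • hsum + hcoef' • p₁

end IsAntihomogeneousOrderAntimorphism

/-! ### The Gateaux derivative -/

theorem hasLineDerivAt_of_map_eq_inv {V : Type*} [NormedAddCommGroup V] [NormedSpace ℝ V]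
    {g : V → V} {p q p' q' : V}
    (hpq : ∀ α β : ℝ, 0 < α → 0 < β → g (α • p + β • q) = α⁻¹ • p' + β⁻¹ • q') (a b : ℝ) :
    HasLineDerivAt ℝ g (-(a • p' + b • q')) (p + q) (a • p + b • q) := by
  have hcoord : ∀ a : ℝ, HasDerivAt (fun t : ℝ => (1 + t * a)⁻¹) (-a) 0 := by
    intro a
    have h₁ : HasDerivAt (fun t : ℝ => 1 + t * a) a 0 := by
      simpa using ((hasDerivAt_id (0 : ℝ)).mul_const a).const_add 1
    simpa using h₁.fun_inv (by simp)
  have hpos : ∀ a : ℝ, ∀ᶠ t in 𝓝 (0 : ℝ), 0 < 1 + t * a := fun a =>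
    (show Continuous fun t : ℝ => 1 + t * a by fun_prop).tendsto' 0 1 (by simp)
      |>.eventually (lt_mem_nhds one_pos)
  have hd := ((hcoord a).smul_const p').fun_add ((hcoord b).smul_const q')
  rw [show -a • p' + -b • q' = -(a • p' + b • q') by module] at hd
  refine hd.congr_of_eventuallyEq ?_
  filter_upwards [hpos a, hpos b] with t ha hb
  rw [← hpq _ _ ha hb]
  congr 1
  module

namespace IsAntihomogeneousOrderAntimorphism

variable {V : Type*} [NormedAddCommGroup V] [NormedSpace ℝ V] {C : PointedCone ℝ V} {u : V}
  {g h : V → V}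

/-- Every `z` lies in a plane through `x` with coordinates in which `x` is `(1, 1)` and `g` is
coordinatewise inversion. For `z` on the line of `x` the second coordinate vector is `0`. -/
theorem exists_coordinates (hg : IsAntihomogeneousOrderAntimorphism C g)
    (hV : IsOrderUnitSpace C u) (hC : IsStrictlyConvexCone C) [Nontrivial V] {x : V}
    (hx : x ∈ interior (C : Set V)) (z : V) :
    ∃ p q p' q' : V, ∃ a b : ℝ, p ∈ C ∧ q ∈ C ∧ p + q = x ∧ p' + q' = g x ∧
      z = a • p + b • q ∧ (z ∈ interior (C : Set V) → 0 < a ∧ 0 < b) ∧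
      ∀ α β : ℝ, 0 < α → 0 < β → g (α • p + β • q) = α⁻¹ • p' + β⁻¹ • q' := by
  obtain ⟨c, rfl⟩ | ⟨p, q, a, b, hp, hp', hq, hq', rfl, rfl⟩ :=
    hV.exists_boundary_decomposition hx z
  · refine ⟨x, 0, g x, 0, c, c, interior_subset hx, C.zero_mem, by simp, by simp, by simp,
      fun hi => ?_, fun α β hα _ => by simp [hg.antihomogeneous α hα x hx]⟩
    have := hV.pos_of_smul_mem_interior (interior_subset hx) hi
    exact ⟨this, this⟩
  · obtain ⟨p', q', h⟩ := hg.exists_map_eq_inv hV hC hp hp' hq hq' hx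
    have hpos : ∀ {p q : V} {a b : ℝ}, p ∈ C → q ∈ C → q ∉ interior (C : Set V) →
        a • p + b • q ∈ interior (C : Set V) → 0 < a := by
      intro p q a b hp hq hq' hi
      by_contra! ha
      refine hV.smul_notMem_interior hq hq' b ?_
      convert hV.add_mem_interior hi (PointedCone.smul_mem C (neg_nonneg.2 ha) hp) using 1
      module
    refine ⟨p, q, p', q', a, b, hp, hq, rfl, ?_, rfl, fun hi => ⟨hpos hp hq hq' hi,
      hpos hq hp hp' (add_comm (a • p) _ ▸ hi)⟩, h⟩
    simpa using (h 1 1 one_pos one_pos).symm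

theorem hasLineDerivAt (hg : IsAntihomogeneousOrderAntimorphism C g)
    (hV : IsOrderUnitSpace C u) (hC : IsStrictlyConvexCone C) [Nontrivial V] {x : V}
    (hx : x ∈ interior (C : Set V)) (z : V) : HasLineDerivAt ℝ g (lineDeriv ℝ g x z) x z := by
  obtain ⟨p, q, p', q', a, b, -, -, rfl, -, rfl, -, h⟩ := hg.exists_coordinates hV hC hx z
  exact (hasLineDerivAt_of_map_eq_inv h a b).lineDifferentiableAt.hasLineDerivAt

/-- Moving `z` along `x` changes both coordinates of `z` by the same amount. -/
theorem lineDeriv_add_smul (hg : IsAntihomogeneousOrderAntimorphism C g)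
    (hV : IsOrderUnitSpace C u) (hC : IsStrictlyConvexCone C) [Nontrivial V] {x : V}
    (hx : x ∈ interior (C : Set V)) (s : ℝ) (z : V) :
    -lineDeriv ℝ g x (z + s • x) = -lineDeriv ℝ g x z + s • g x := by
  obtain ⟨p, q, p', q', a, b, -, -, rfl, e, rfl, -, h⟩ := hg.exists_coordinates hV hC hx z
  rw [show a • p + b • q + s • (p + q) = (a + s) • p + (b + s) • q by module,
    (hasLineDerivAt_of_map_eq_inv h _ _).lineDeriv, (hasLineDerivAt_of_map_eq_inv h _ _).lineDeriv,
    ← e]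
  module

/-- The negative Gateaux derivative is isotone, as a limit of difference quotients of the antitone
map `g` in the closed cone `C`. -/
theorem lineDeriv_sub_mem (hg : IsAntihomogeneousOrderAntimorphism C g)
    (hV : IsOrderUnitSpace C u) (hC : IsStrictlyConvexCone C) [Nontrivial V] {x z w : V}
    (hx : x ∈ interior (C : Set V)) (hzw : w - z ∈ C) :
    -lineDeriv ℝ g x w - -lineDeriv ℝ g x z ∈ C := by
  have hd : HasDerivAt (fun t : ℝ => g (x + t • z) - g (x + t • w))
      (lineDeriv ℝ g x z - lineDeriv ℝ g x w) 0 :=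
    HasDerivAt.sub (hg.hasLineDerivAt hV hC hx z) (hg.hasLineDerivAt hV hC hx w)
  have hev : ∀ v : V, ∀ᶠ t in 𝓝[>] (0 : ℝ), x + t • v ∈ interior (C : Set V) := fun v =>
    nhdsWithin_le_nhds ((show Continuous fun t : ℝ => x + t • v by fun_prop).tendsto' 0 x (by simp)
      |>.eventually (isOpen_interior.mem_nhds hx))
  have := hV.isClosed.mem_of_tendsto hd.tendsto_slope_zero_right (by
    filter_upwards [hev z, hev w, self_mem_nhdsWithin] with t hz hw ht
    have ht : 0 < t := ht
    simp only [zero_add, zero_smul, add_zero, sub_self, sub_zero]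
    refine PointedCone.smul_mem C (inv_pos.2 ht).le ((hg.sub_mem_iff hz hw).1 ?_)
    convert PointedCone.smul_mem C ht.le hzw using 1
    module)
  rwa [neg_sub_neg]

/-- The derivatives of `g` at `x` and of `g⁻¹` at `g x` are inverse to each other, because in the
coordinates of `exists_coordinates` both maps are coordinatewise inversion. -/
theorem lineDeriv_lineDeriv (hg : IsAntihomogeneousOrderAntimorphism C g)
    (hV : IsOrderUnitSpace C u) (hC : IsStrictlyConvexCone C) [Nontrivial V]
    (hl : LeftInvOn h g (interior C)) {x : V} (hx : x ∈ interior (C : Set V)) (z : V) :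
    -lineDeriv ℝ h (g x) (-lineDeriv ℝ g x z) = z := by
  obtain ⟨p, q, p', q', a, b, hp, hq, rfl, e, rfl, -, H⟩ := hg.exists_coordinates hV hC hx z
  have H' : ∀ α β : ℝ, 0 < α → 0 < β → h (α • p' + β • q') = α⁻¹ • p + β⁻¹ • q := by
    intro α β hα hβ
    have := H α⁻¹ β⁻¹ (inv_pos.2 hα) (inv_pos.2 hβ)
    rw [inv_inv, inv_inv] at this
    rw [← this, hl (hV.smul_add_smul_mem_interior hp hq hx (inv_pos.2 hα) (inv_pos.2 hβ))]
  rw [(hasLineDerivAt_of_map_eq_inv H a b).lineDeriv, neg_neg, ← e,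
    (hasLineDerivAt_of_map_eq_inv H' a b).lineDeriv, neg_neg]

/-- The negative Gateaux derivative of `g` at `x` is a linear homeomorphism and an order
isomorphism. -/
theorem exists_continuousLinearEquiv (hg : IsAntihomogeneousOrderAntimorphism C g)
    (hV : IsOrderUnitSpace C u) (hC : IsStrictlyConvexCone C) [Nontrivial V] {x : V}
    (hx : x ∈ interior (C : Set V)) :
    ∃ G : V ≃L[ℝ] V, (∀ z, G z = -lineDeriv ℝ g x z) ∧ ∀ z, z ∈ C ↔ G z ∈ C := by
  set h := Function.invFunOn g (interior (C : Set V)) with hh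
  have hinv : InvOn h g (interior C) (interior C) := hg.bijOn.invOn_invFunOn
  have hmaps : MapsTo h (interior C) (interior C) := (hg.bijOn.symm hinv.symm).mapsTo
  have hh' := hg.of_invOn hV hinv.1 hinv.2 hmaps
  have hgx : g x ∈ interior (C : Set V) := hg.bijOn.mapsTo hx
  have hleft : ∀ z, -lineDeriv ℝ h (g x) (-lineDeriv ℝ g x z) = z :=
    hg.lineDeriv_lineDeriv hV hC hinv.1 hx
  have hright : ∀ z, -lineDeriv ℝ g x (-lineDeriv ℝ h (g x) z) = z := fun z => by
    have := hh'.lineDeriv_lineDeriv hV hC hinv.2 hgx z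
    rwa [hinv.1 hx] at this
  let E : V ≃ V := ⟨fun z => -lineDeriv ℝ g x z, fun z => -lineDeriv ℝ h (g x) z, hleft, hright⟩
  have hle : ∀ z w, w - z ∈ C ↔ E w - E z ∈ C := fun z w =>
    ⟨hg.lineDeriv_sub_mem hV hC hx, fun H => by
      have := hh'.lineDeriv_sub_mem hV hC hgx H
      simpa only [E, Equiv.coe_fn_mk, hleft] using this⟩
  have h0 : E 0 = 0 := by simp [E, lineDeriv_zero]
  have hlin : IsLinearMap ℝ E := hV.isLinearMap_of_monotone hx hgx E h0 hle
    (hg.lineDeriv_add_smul hV hC hx)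
  have hmem : ∀ z, z ∈ C ↔ E z ∈ C := fun z => by simpa [h0] using hle 0 z
  let L : V ≃ₗ[ℝ] V := { E with map_add' := hlin.map_add, map_smul' := hlin.map_smul }
  obtain ⟨K, hK⟩ := hV.exists_norm_le_mul hlin fun z hz => (hmem z).1 hz
  obtain ⟨K', hK'⟩ := hV.exists_norm_le_mul L.symm.toLinearMap.isLinear fun z hz =>
    (hmem _).2 (by simpa [L] using (E.apply_symm_apply z).symm ▸ hz)
  exact ⟨L.toContinuousLinearEquivOfBounds K K' hK hK', fun z => rfl, hmem⟩

theorem symm_comp (hg : IsAntihomogeneousOrderAntimorphism C g) (G : V ≃L[ℝ] V)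
    (hG : ∀ z, z ∈ C ↔ G z ∈ C) : IsAntihomogeneousOrderAntimorphism C (G.symm ∘ g) := by
  have himg : G.symm '' (C : Set V) = C := by
    ext z
    rw [ContinuousLinearEquiv.image_symm_eq_preimage]
    exact (hG z).symm
  have hint : G.symm '' interior (C : Set V) = interior C := by
    have := G.symm.toHomeomorph.image_interior (C : Set V)
    simpa [himg] using this
  refine ⟨?_, fun x hx y hy => ?_, fun r hr x hx => ?_⟩
  · have := G.symm.injective.injOn.bijOn_image (s := interior (C : Set V))
    rw [hint] at this
    exact this.comp hg.bijOn
  · rw [hg.antitone_iff x hx y hy]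
    simp only [coneLE, Function.comp_apply]
    rw [hG (G.symm _ - _), map_sub, G.apply_symm_apply, G.apply_symm_apply]
  · simp [hg.antihomogeneous r hr x hx]

end IsAntihomogeneousOrderAntimorphism

theorem theorem2p8 {V : Type*} [NormedAddCommGroup V] [NormedSpace ℝ V]
    (C : PointedCone ℝ V) (u : V) (hV : IsOrderUnitSpace C u) (hC : IsStrictlyConvexCone C)
    (g : V → V) (hg : IsAntihomogeneousOrderAntimorphism C g)
    (x : V) (hx : x ∈ interior (C : Set V)) :
    ∃ G : V ≃L[ℝ] V,
      (∀ z : V, HasLineDerivAt ℝ g (-(G z)) x z) ∧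
      G '' (C : Set V) = (C : Set V) ∧
      IsAntihomogeneousOrderAntimorphism C (G.symm ∘ g) ∧
      (G.symm ∘ g) x = x ∧
      ∀ y ∈ interior (C : Set V), (G.symm ∘ g) ((G.symm ∘ g) y) = y := by
  -- In the zero space `0` is an interior point of the cone, so this case is separate.
  rcases subsingleton_or_nontrivial V with hsub | hnt
  · refine ⟨ContinuousLinearEquiv.refl ℝ V, fun z => ?_, by simp, hg, Subsingleton.elim _ _,
      fun y _ => Subsingleton.elim _ _⟩
    rw [HasLineDerivAt]
    convert hasDerivAt_const (0 : ℝ) (0 : V) using 1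
  obtain ⟨G, hG, hGC⟩ := hg.exists_continuousLinearEquiv hV hC hx
  -- `G` takes `p` to `p'` and `q` to `q'`, so `G⁻¹ ∘ g` is coordinatewise inversion in the plane
  -- of `p` and `q`.
  have hS : ∀ y ∈ interior (C : Set V), ∃ p q : V, ∃ a b : ℝ, 0 < a ∧ 0 < b ∧
      y = a • p + b • q ∧
      ∀ α β : ℝ, 0 < α → 0 < β → G.symm (g (α • p + β • q)) = α⁻¹ • p + β⁻¹ • q := by
    intro y hy
    obtain ⟨p, q, p', q', a, b, -, -, rfl, -, e, hpos, H⟩ := hg.exists_coordinates hV hC hx y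
    refine ⟨p, q, a, b, (hpos hy).1, (hpos hy).2, e, fun α β hα hβ => ?_⟩
    rw [ContinuousLinearEquiv.symm_apply_eq, hG, H α β hα hβ,
      (hasLineDerivAt_of_map_eq_inv H _ _).lineDeriv, neg_neg]
  refine ⟨G, fun z => ?_, ?_, hg.symm_comp G hGC, ?_, fun y hy => ?_⟩
  · rw [hG, neg_neg]
    exact hg.hasLineDerivAt hV hC hx z
  · ext z
    rw [ContinuousLinearEquiv.image_eq_preimage_symm]
    exact (hGC _).trans (by rw [G.apply_symm_apply]; rfl)
  · have := hg.lineDeriv_add_smul hV hC hx 1 0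
    rw [Function.comp_apply, ContinuousLinearEquiv.symm_apply_eq, hG]
    simpa [lineDeriv_zero] using this.symm
  · obtain ⟨p, q, a, b, ha, hb, rfl, H⟩ := hS y hy
    simp only [Function.comp_apply]
    rw [H a b ha hb, H _ _ (inv_pos.2 ha) (inv_pos.2 hb), inv_inv, inv_inv]
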